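/- Let $\mathsf P^n=\{I,X,Y,Z\}^{\otimes n}$ be the set of $n$-qubit Pauli operators $P_a$. An $n$-qubit Pauli channel is a map $\Lambda(\rho)=\sum_{b\in\mathsf P^n}p_bP_b\rho P_b$ with $p_b\ge 0$ and $\sum_b p_b=1$; its Pauli eigenvalues are $\lambda_a=2^{-n}\mathrm{Tr}[P_a\Lambda(P_a)]$. For a non-empty $B\subseteq\mathsf P^n\setminus\{I\}$ put $$\lambda_B:=\mathrm{sgn}\Big(\prod_{b\in B}\lambda_b\Big)\,\Big|\prod_{b\in B}\lambda_b\Big|^{1/|B|}.$$ An entanglement-free (classical-memory-assisted) scheme using $M\ge1$ copies of a channel $\Lambda$ on $n$ qubits consists of finite outcome alphabets; an ensemble of positive semidefinite operators $\rho_{o_0}$ with total trace $1$; for $1\le t\le M-1$ and every string of previous outcomes $o_{<t}=(o_0,\dots,o_{t-1})$ a quantum instrument $\{\mathcal C^{o_{<t}}_{o_t}\}_{o_t}$ (completely positive maps on the $n$-qubit system whose sum is trace preserving); and for every $o_{<M}$ a POVM $\{E^{o_{<M}}_{o_M}\}_{o_M}$. Its outcome string $o=(o_0,\dots,o_M)$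 has distribution $$\Pr[o\,|\,\Lambda]=\mathrm{Tr}\Big[E^{o_{<M}}_{o_M}\big(\Lambda\circ\mathcal C^{o_{<M-1}}_{o_{M-1}}\circ\cdots\circ\Lambda\circ\mathcal C^{o_{<1}}_{o_1}\circ\Lambda\big)(\rho_{o_0})\Big],$$ and its estimates are real-valued functions of $o$. An instrument is trivial if each of its branches is proportional to a completely positive trace-preserving map. The number of measurements of the scheme is the maximum, over all outcome strings, of the number of non-trivial instruments used along the string, plus one for the final POVM. Theorem. There is a universal constant $c>0$ such that the following holds. Let $n\ge1$, let $\mathbf B$ be a partition of $\mathsf P^n\setminus\{I\}$ into non-empty blocks of size at most $C$, and let $0<\varepsilon\le 1/(6C)$. Suppose that an entanglement-free scheme, with any number of copies, has estimators $\widehat\lambda_B$, $B\in\mathbf B$, such that for every $n$-qubit Pauli channel $\Lambda$ and every single block $B\in\mathbf B$ $$\Pr\big[\,|\widehat\lambda_B-\lambda_B|\le\varepsilon\ \big|\ \Lambda\big]\ge\tfrac23 .$$ Then its number of measurements $N$ satisfies $N\ge c\,2^n\varepsilon^{-2}C^{-2}$. -/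

import Mathlib

noncomputable section

namespace PauliLearning

open scoped Matrix ComplexOrder

/-- Linear operators on the `n`-qubit Hilbert space, in the computational basis. -/
abbrev Op (n : ℕ) : Type := Matrix (Fin n → Fin 2) (Fin n → Fin 2) ℂ

/-- Linear maps on operators (superoperators). -/
abbrev SuperOp (n : ℕ) : Type := Op n →ₗ[ℂ] Op n

/-! ### Pauli operators and Pauli channels -/

/-- The `n`-qubit Pauli group modulo phase: the `k`-th entry is the pair `(a_{x,k}, a_{z,k})`.
The identity Pauli is `0`. -/
abbrev PauliIdx (n : ℕ) : Type := Fin n → ZMod 2 × ZMod 2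

/-- The single-qubit Pauli operator `i^{xz} X^x Z^z`, that is `I`, `Z`, `X`, `Y` for
`(x, z) = (0, 0), (0, 1), (1, 0), (1, 1)`. -/
def pauli1 (a : ZMod 2 × ZMod 2) : Matrix (Fin 2) (Fin 2) ℂ :=
  Complex.I ^ (a.1.val * a.2.val) •
    ((!![0, 1; 1, 0] : Matrix (Fin 2) (Fin 2) ℂ) ^ a.1.val *
      (!![1, 0; 0, -1] : Matrix (Fin 2) (Fin 2) ℂ) ^ a.2.val)

/-- The `n`-qubit Pauli operator `P_a`, the tensor product of single-qubit Paulis. -/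
def pauli {n : ℕ} (a : PauliIdx n) : Op n :=
  Matrix.of fun x y => ∏ k, pauli1 (a k) (x k) (y k)

/-- The map `ρ ↦ ∑_b p_b P_b ρ P_b`. It is a Pauli channel when the error rates `p` form a
probability vector. -/
def pauliChannel {n : ℕ} (p : PauliIdx n → ℝ) : SuperOp n :=
  ∑ b, (p b : ℂ) • (LinearMap.mulLeft ℂ (pauli b) ∘ₗ LinearMap.mulRight ℂ (pauli b))

/-- The Pauli eigenvalue (Pauli fidelity) `λ_a = Tr[P_a Λ(P_a)] / 2^n`. -/
def pauliEigenvalue {n : ℕ} (Λ : SuperOp n) (a : PauliIdx n) : ℝ :=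
  (pauli a * Λ (pauli a)).trace.re / 2 ^ n

/-- The geometrically averaged Pauli fidelity of a block `B`:
`sgn(∏_{b ∈ B} λ_b) * |∏_{b ∈ B} λ_b|^{1/|B|}`. -/
def geomFidelity {n : ℕ} (Λ : SuperOp n) (B : Finset (PauliIdx n)) : ℝ :=
  Real.sign (∏ b ∈ B, pauliEigenvalue Λ b) *
    |∏ b ∈ B, pauliEigenvalue Λ b| ^ ((1 : ℝ) / (B.card : ℝ))

/-! ### Channels and instruments -/

/-- Complete positivity: for every `k`, applying `Φ` to the blocks of a positive semidefinite
`k × k` block matrix gives a positive semidefinite block matrix. -/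
def IsCP {n : ℕ} (Φ : SuperOp n) : Prop :=
  ∀ (k : ℕ) (M : Matrix (Fin k) (Fin k) (Op n)),
    (Matrix.comp (Fin k) (Fin k) _ _ ℂ M).PosSemidef →
      (Matrix.comp (Fin k) (Fin k) _ _ ℂ (M.map Φ)).PosSemidef

/-- Trace preservation. -/
def IsTP {n : ℕ} (Φ : SuperOp n) : Prop :=
  ∀ ρ : Op n, (Φ ρ).trace = ρ.trace

/-- A quantum instrument with finitely many outcomes: completely positive maps whose sum is trace
preserving (hence each of them is trace non-increasing). -/
def IsInstrument {n : ℕ} {α : Type} [Fintype α] (Φ : α → SuperOp n) : Prop :=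
  (∀ o, IsCP (Φ o)) ∧ IsTP (∑ o, Φ o)

/-- An instrument is trivial if each of its branches is proportional to a CPTP map. -/
def IsTrivialInstrument {n : ℕ} {α : Type} (Φ : α → SuperOp n) : Prop :=
  ∀ o, ∃ (r : ℝ) (Ψ : SuperOp n), IsCP Ψ ∧ IsTP Ψ ∧ Φ o = (r : ℂ) • Ψ

/-- A POVM with finitely many outcomes. -/
def IsPOVM {n : ℕ} {α : Type} [Fintype α] (E : α → Op n) : Prop :=
  (∀ o, (E o).PosSemidef) ∧ ∑ o, E o = 1

/-- An ensemble of sub-normalized states with total trace one. -/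
def IsEnsemble {n : ℕ} {α : Type} [Fintype α] (ρ : α → Op n) : Prop :=
  (∀ o, (ρ o).PosSemidef) ∧ (∑ o, ρ o).trace = 1

/-! ### Classical-memory-assisted (entanglement-free) schemes -/

/-- Outcome strings `o_{<t} = (o_0, …, o_{t-1})`, where `o_i` takes values in `A i`. -/
abbrev History (A : ℕ → Type) (t : ℕ) : Type := (i : Fin t) → A i

/-- The prefix `o_{<s}` of an outcome string `o_{<t}`, for `s ≤ t`. -/
def History.take {A : ℕ → Type} {t : ℕ} (o : History A t) (s : ℕ) (h : s ≤ t) : History A s :=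
  fun i => o (Fin.castLE h i)

/-- A classical-memory-assisted scheme on `n` qubits that uses `m + 1` copies of the unknown
channel: an ensemble of initial states (outcome `o_0`), adaptively chosen instruments at the times
`t = 1, …, m` (outcome `o_t`), and an adaptively chosen final POVM (outcome `o_{m+1}`). The values
of `instr` at other times are never used. -/
structure Scheme (n m : ℕ) where
  /-- The finite outcome alphabets. -/
  A : ℕ → Type
  [fintypeA : ∀ i, Fintype (A i)]
  /-- The sub-normalized initial states `ρ_{o_0}`. -/
  init : A 0 → Op n
  init_ensemble : IsEnsemble init
  /-- The branches `C_{o_t}^{o_{<t}}` of the instruments. -/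
  instr : (t : ℕ) → History A t → A t → SuperOp n
  instr_instrument : ∀ t, 1 ≤ t → t ≤ m → ∀ h : History A t, IsInstrument (instr t h)
  /-- The final POVM elements `E_{o_{m+1}}^{o_{<m+1}}`. -/
  povm : History A (m + 1) → A (m + 1) → Op n
  povm_povm : ∀ h, IsPOVM (povm h)

attribute [instance] Scheme.fintypeA

namespace Scheme

variable {n m : ℕ} (S : Scheme n m)

/-- Complete outcome strings `(o_0, …, o_{m+1})`. -/
abbrev Outcome : Type := History S.A (m + 2)

/-- The unnormalized state `(C_{o_t}^{o_{<t}} ∘ Λ ∘ ⋯ ∘ C_{o_1}^{o_0} ∘ Λ)(ρ_{o_0})`, as a function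
of the outcomes `(o_0, …, o_t)`. -/
def state (Λ : SuperOp n) : (t : ℕ) → History S.A (t + 1) → Op n
  | 0, o => S.init (o (Fin.last 0))
  | t + 1, o =>
      S.instr (t + 1) (o.take (t + 1) (Nat.le_succ _)) (o (Fin.last (t + 1)))
        (Λ (state Λ t (o.take (t + 1) (Nat.le_succ _))))

/-- The probability `Pr[o | Λ]` of a complete outcome string. -/
def prob (Λ : SuperOp n) (o : S.Outcome) : ℝ :=
  (S.povm (o.take (m + 1) (Nat.le_succ _)) (o (Fin.last (m + 1))) *
    Λ (S.state Λ m (o.take (m + 1) (Nat.le_succ _)))).trace.re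

open Classical in
/-- The probability of an event, that is, of a set of complete outcome strings. -/
def probEvent (Λ : SuperOp n) (s : Set S.Outcome) : ℝ :=
  ∑ o : S.Outcome, if o ∈ s then S.prob Λ o else 0

open Classical in
/-- The number of measurements: the worst case, over all outcome strings, of the number of
non-trivial instruments used, where the final POVM is counted as well. -/
def numMeas : ℕ :=
  (Finset.univ : Finset (History S.A (m + 1))).sup fun o =>
    ((Finset.univ : Finset (Fin (m + 1))).filter fun t : Fin (m + 1) =>
      1 ≤ (t : ℕ) ∧ ¬ IsTrivialInstrument (S.instr t (o.take (t : ℕ) t.isLt.le))).card + 1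

/-- With outputs `est B` computed from the outcome string, the scheme estimates, for every Pauli
channel and every block `B` of the partition, the geometrically averaged Pauli fidelity of `B` to
additive precision `ε` with probability at least `2/3` (for each block individually). -/
def Learns (𝓑 : Finset (Finset (PauliIdx n))) (est : Finset (PauliIdx n) → S.Outcome → ℝ)
    (ε : ℝ) : Prop :=
  ∀ p ∈ stdSimplex ℝ (PauliIdx n), ∀ B ∈ 𝓑,
    2 / 3 ≤ S.probEvent (pauliChannel p)
      {o | |est B o - geomFidelity (pauliChannel p) B| ≤ ε}

end Scheme

end PauliLearning

end

noncomputable section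

namespace PauliLearning

open scoped Matrix ComplexOrder

/-! ### Single-qubit Pauli operators -/

/-! The null channel replaces every input by a multiple of the identity. For a block `B`, the
alternative also gives every Pauli in `B` the eigenvalue `3 * ε`. An estimator with error `ε` must
tell these two channels apart, which forces relative entropy at least `1 / 9` from the null outcome
law to the law for `B` (`one_div_nine_le_relative_entropy`).

The chain rule splits this entropy over the uses of the channel. In each use the instrument matters
only through its effects `E o`. Under the null channel, outcome `o` has conditional probability `(E
o).trace / 2 ^ n` whatever the current state. The alternative multiplies it by `1 + δ o`, where `δ`
is `η = 3 * ε` times the sum over `B` of products of normalized Pauli expectations of the state and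
of the effect. Paulis other than the identity are traceless, so `δ` has null mean zero and costs
only second order. Cauchy–Schwarz removes the state and leaves a bound depending on the measurement
alone (`exists_likelihood_ratio`).

All alternatives can therefore be averaged under one null law. Parseval and `Tr E² ≤ (Tr E)²` bound
the total gain of one measurement over all blocks by `2 * η ^ 2 * C * 2 ^ n` (`sum_infoGain_le`),
while a trivial instrument gains nothing. A partition has at least about `4 ^ n / C` blocks, each
needing `1 / 9`; comparing the two counts gives the bound. -/

lemma sum_zmod_two_prod {M : Type*} [AddCommMonoid M] (f : ZMod 2 × ZMod 2 → M) :
    ∑ a, f a = f (0, 0) + f (0, 1) + (f (1, 0) + f (1, 1)) := by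
  rw [Fintype.sum_prod_type]
  have h : ∀ g : ZMod 2 → M, ∑ x, g x = g 0 + g 1 := fun g => Fin.sum_univ_two g
  rw [h, h, h]

lemma forall_zmod_two_prod {q : ZMod 2 × ZMod 2 → Prop} (h00 : q (0, 0)) (h01 : q (0, 1))
    (h10 : q (1, 0)) (h11 : q (1, 1)) (a : ZMod 2 × ZMod 2) : q a := by
  obtain ⟨x, z⟩ := a
  fin_cases x <;> fin_cases z <;> assumption

lemma zmod_two_val_one : (1 : ZMod 2).val = 1 := rfl

lemma pauli1_zero_zero : pauli1 (0, 0) = !![1, 0; 0, 1] := by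
  simp [pauli1, Matrix.one_fin_two]

lemma pauli1_zero_one : pauli1 (0, 1) = !![1, 0; 0, -1] := by
  simp [pauli1, zmod_two_val_one]

lemma pauli1_one_zero : pauli1 (1, 0) = !![0, 1; 1, 0] := by
  simp [pauli1, zmod_two_val_one]

lemma pauli1_one_one : pauli1 (1, 1) = !![0, -Complex.I; Complex.I, 0] := by
  simp [pauli1, zmod_two_val_one]

lemma sum_pauli1_mul_pauli1 (i j k l : Fin 2) :
    ∑ a, pauli1 a i j * pauli1 a k l = if i = l ∧ j = k then 2 else 0 := by
  rw [sum_zmod_two_prod, pauli1_zero_zero, pauli1_zero_one, pauli1_one_zero, pauli1_one_one]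
  fin_cases i <;> fin_cases j <;> fin_cases k <;> fin_cases l <;> norm_num

lemma pauli1_conjTranspose (a : ZMod 2 × ZMod 2) : (pauli1 a)ᴴ = pauli1 a := by
  induction a using forall_zmod_two_prod <;>
  simp only [pauli1_zero_zero, pauli1_zero_one, pauli1_one_zero, pauli1_one_one] <;>
  ext i j <;> fin_cases i <;> fin_cases j <;> simp

lemma pauli1_mul_self (a : ZMod 2 × ZMod 2) : pauli1 a * pauli1 a = 1 := by
  induction a using forall_zmod_two_prod <;>
  simp [pauli1_zero_zero, pauli1_zero_one, pauli1_one_zero, pauli1_one_one, Matrix.one_fin_two]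

lemma trace_pauli1_mul_pauli1 (a b : ZMod 2 × ZMod 2) :
    (pauli1 a * pauli1 b).trace = if a = b then 2 else 0 := by
  induction a using forall_zmod_two_prod <;> induction b using forall_zmod_two_prod <;>
  simp [pauli1_zero_zero, pauli1_zero_one, pauli1_one_zero, pauli1_one_one,
    Matrix.trace_fin_two] <;> norm_num

/-- The sign `±1` by which two single-qubit Paulis commute. -/
def commSign1 (a b : ZMod 2 × ZMod 2) : ℝ := (-1) ^ (a.1 * b.2 + a.2 * b.1).val

lemma pauli1_conj (a b : ZMod 2 × ZMod 2) :
    pauli1 b * pauli1 a * pauli1 b = (commSign1 a b : ℂ) • pauli1 a := by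
  have h2 : (1 + 1 : ZMod 2) = 0 := rfl
  induction a using forall_zmod_two_prod <;> induction b using forall_zmod_two_prod <;>
  simp [pauli1_zero_zero, pauli1_zero_one, pauli1_one_zero, pauli1_one_one, commSign1,
    zmod_two_val_one, h2]

lemma sum_commSign1_mul_commSign1 (a c : ZMod 2 × ZMod 2) :
    ∑ b, commSign1 a b * commSign1 c b = if a = c then 4 else 0 := by
  have h2 : (1 + 1 : ZMod 2) = 0 := rfl
  rw [sum_zmod_two_prod]
  induction a using forall_zmod_two_prod <;> induction c using forall_zmod_two_prod <;>
  simp [commSign1, zmod_two_val_one, h2] <;> norm_num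

lemma abs_commSign1 (a b : ZMod 2 × ZMod 2) : |commSign1 a b| = 1 := by
  simp [commSign1]

/-! ### `n`-qubit Pauli operators -/

variable {n : ℕ}

/-- The tensor product of single-qubit operators. -/
def tensor (f : Fin n → Matrix (Fin 2) (Fin 2) ℂ) : Op n :=
  Matrix.of fun x y => ∏ k, f k (x k) (y k)

lemma tensor_mul (f g : Fin n → Matrix (Fin 2) (Fin 2) ℂ) :
    tensor f * tensor g = tensor fun k => f k * g k := by
  ext x y
  simp only [tensor, Matrix.mul_apply, Matrix.of_apply, Fintype.prod_sum, Finset.prod_mul_distrib]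

lemma tensor_trace (f : Fin n → Matrix (Fin 2) (Fin 2) ℂ) :
    (tensor f).trace = ∏ k, (f k).trace := by
  simp only [tensor, Matrix.trace, Matrix.diag, Matrix.of_apply, Fintype.prod_sum]

lemma tensor_one : tensor (fun _ : Fin n => (1 : Matrix (Fin 2) (Fin 2) ℂ)) = 1 := by
  ext x y
  simp [tensor, Matrix.one_apply, Finset.prod_boole, funext_iff]

lemma pauli_eq_tensor (a : PauliIdx n) : pauli a = tensor fun k => pauli1 (a k) := rfl

lemma pauli_zero : pauli (0 : PauliIdx n) = 1 := by
  rw [pauli_eq_tensor, ← tensor_one]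
  congr 1
  funext k
  exact pauli1_zero_zero.trans Matrix.one_fin_two.symm

lemma pauli_mul_self (a : PauliIdx n) : pauli a * pauli a = 1 := by
  simp only [pauli_eq_tensor, tensor_mul, pauli1_mul_self, tensor_one]

lemma pauli_conjTranspose (a : PauliIdx n) : (pauli a)ᴴ = pauli a := by
  ext x y
  simp only [Matrix.conjTranspose_apply, pauli, Matrix.of_apply, star_prod]
  refine Finset.prod_congr rfl fun k _ => ?_
  rw [← Matrix.conjTranspose_apply, pauli1_conjTranspose]

lemma prod_ite_const {M : Type*} [CommMonoidWithZero M] (q : Fin n → Prop) [DecidablePred q]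
    (c : M) : ∏ k, (if q k then c else 0) = if ∀ k, q k then c ^ n else 0 := by
  split_ifs with h
  · simp [h]
  · push Not at h
    obtain ⟨k, hk⟩ := h
    exact Finset.prod_eq_zero (Finset.mem_univ k) (if_neg hk)

lemma trace_pauli_mul_pauli (a b : PauliIdx n) :
    (pauli a * pauli b).trace = if a = b then 2 ^ n else 0 := by
  simp only [pauli_eq_tensor, tensor_mul, tensor_trace, trace_pauli1_mul_pauli1, prod_ite_const,
    funext_iff]

lemma trace_pauli {a : PauliIdx n} (ha : a ≠ 0) : (pauli a).trace = 0 := by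
  have h := trace_pauli_mul_pauli a 0
  rwa [pauli_zero, mul_one, if_neg ha] at h

/-- Completeness of the Pauli operators: `∑_a P_a ⊗ P_a` is `2^n` times the swap operator. -/
lemma sum_pauli_mul_pauli (i j k l : Fin n → Fin 2) :
    ∑ a : PauliIdx n, pauli a i j * pauli a k l = if i = l ∧ j = k then 2 ^ n else 0 := by
  simp only [pauli, Matrix.of_apply, ← Finset.prod_mul_distrib]
  rw [← Fintype.prod_sum fun q a => pauli1 a (i q) (j q) * pauli1 a (k q) (l q)]
  simp only [sum_pauli1_mul_pauli1, prod_ite_const, funext_iff, forall_and]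

lemma sum_trace_smul_pauli (X : Op n) :
    ∑ a : PauliIdx n, (pauli a * X).trace • pauli a = (2 ^ n : ℂ) • X := by
  ext k l
  simp only [Matrix.sum_apply, Matrix.smul_apply, Matrix.trace, Matrix.diag, Matrix.mul_apply,
    smul_eq_mul, Finset.sum_mul]
  rw [Finset.sum_comm]
  simp_rw [Finset.sum_comm (s := (Finset.univ : Finset (PauliIdx n)))]
  have h : ∀ i j, ∑ a : PauliIdx n, pauli a i j * X j i * pauli a k l =
      (if i = l ∧ j = k then 2 ^ n else 0) * X j i := by
    intro i j
    rw [← sum_pauli_mul_pauli, Finset.sum_mul]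
    exact Finset.sum_congr rfl fun a _ => by ring
  simp_rw [h, ite_and]
  simp

/-- Parseval's identity in the Pauli basis. -/
lemma sum_trace_pauli_mul_trace_pauli (X Y : Op n) :
    ∑ a : PauliIdx n, (pauli a * X).trace * (Y * pauli a).trace = 2 ^ n * (Y * X).trace := by
  have h := congrArg (fun Z => (Y * Z).trace) (sum_trace_smul_pauli X)
  simpa [Finset.mul_sum, Matrix.trace_sum] using h

/-- The sign `±1` by which two Paulis commute. -/
def commSign (a b : PauliIdx n) : ℝ := ∏ k, commSign1 (a k) (b k)

lemma abs_commSign (a b : PauliIdx n) : |commSign a b| = 1 := by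
  simp [commSign, Finset.abs_prod, abs_commSign1]

lemma commSign_zero (b : PauliIdx n) : commSign 0 b = 1 := by
  simp [commSign, commSign1]

lemma pauli_conj (a b : PauliIdx n) :
    pauli b * pauli a * pauli b = (commSign a b : ℂ) • pauli a := by
  simp only [pauli_eq_tensor, tensor_mul, pauli1_conj]
  ext x y
  simp [tensor, commSign, Finset.prod_mul_distrib]

lemma sum_commSign_mul_commSign (a c : PauliIdx n) :
    ∑ b, commSign a b * commSign c b = if a = c then 4 ^ n else 0 := by
  simp only [commSign, ← Finset.prod_mul_distrib]
  rw [← Fintype.prod_sum fun k b => commSign1 (a k) b * commSign1 (c k) b]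
  simp only [sum_commSign1_mul_commSign1, prod_ite_const, funext_iff]

lemma sum_commSign (a : PauliIdx n) : ∑ b, commSign a b = if a = 0 then 4 ^ n else 0 := by
  simpa [commSign_zero] using sum_commSign_mul_commSign a 0

/-! ### Pauli channels -/

lemma pauliChannel_apply (p : PauliIdx n → ℝ) (X : Op n) :
    pauliChannel p X = ∑ b, (p b : ℂ) • (pauli b * X * pauli b) := by
  simp [pauliChannel, LinearMap.sum_apply, mul_assoc]

lemma pauliChannel_pauli (p : PauliIdx n → ℝ) (a : PauliIdx n) :
    pauliChannel p (pauli a) = ((∑ b, p b * commSign a b : ℝ) : ℂ) • pauli a := by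
  rw [pauliChannel_apply, Complex.ofReal_sum, Finset.sum_smul]
  simp only [pauli_conj, smul_smul, Complex.ofReal_mul]

lemma pauliEigenvalue_pauliChannel (p : PauliIdx n → ℝ) (a : PauliIdx n) :
    pauliEigenvalue (pauliChannel p) a = ∑ b, p b * commSign a b := by
  rw [pauliEigenvalue, pauliChannel_pauli, Matrix.mul_smul, pauli_mul_self, Matrix.trace_smul,
    Matrix.trace_one, smul_eq_mul, Complex.re_ofReal_mul, Complex.natCast_re]
  simp

lemma pauliChannel_isTP {p : PauliIdx n → ℝ} (hp : p ∈ stdSimplex ℝ (PauliIdx n)) :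
    IsTP (pauliChannel p) := by
  intro X
  rw [pauliChannel_apply, Matrix.trace_sum]
  have h : ∀ b, ((p b : ℂ) • (pauli b * X * pauli b)).trace = (p b : ℂ) * X.trace := by
    intro b
    rw [Matrix.trace_smul, Matrix.trace_mul_comm, ← mul_assoc, pauli_mul_self, one_mul, smul_eq_mul]
  simp_rw [h]
  rw [← Finset.sum_mul, ← Complex.ofReal_sum, hp.2, Complex.ofReal_one, one_mul]

lemma pauliChannel_posSemidef {p : PauliIdx n → ℝ} (hp : p ∈ stdSimplex ℝ (PauliIdx n))
    {X : Op n} (hX : X.PosSemidef) : (pauliChannel p X).PosSemidef := by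
  rw [pauliChannel_apply]
  refine Matrix.posSemidef_sum _ fun b _ => ?_
  have h := hX.mul_mul_conjTranspose_same (pauli b)
  rw [pauli_conjTranspose] at h
  exact h.smul (Complex.zero_le_real.2 (hp.1 b))

/-- The error rates of the Pauli channel with eigenvalue `η` on `B`, `1` at the identity, and `0`
elsewhere. -/
def blockRates (η : ℝ) (B : Finset (PauliIdx n)) (b : PauliIdx n) : ℝ :=
  (1 + η * ∑ a ∈ B, commSign a b) / 4 ^ n

/-- A sum of `B.card` signs is at least `-B.card`, which gives nonnegativity. The total is one
because nontrivial sign characters sum to zero, hence the need for `0 ∉ B`. -/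
lemma blockRates_mem_stdSimplex {η : ℝ} {B : Finset (PauliIdx n)} (hB : 0 ∉ B)
    (h0 : 0 ≤ η) (hη : η * B.card ≤ 1) : blockRates η B ∈ stdSimplex ℝ (PauliIdx n) := by
  constructor
  · intro b
    have h : -(B.card : ℝ) ≤ ∑ a ∈ B, commSign a b := by
      have := (Finset.abs_sum_le_sum_abs (fun a => commSign a b) B)
      simp only [abs_commSign, Finset.sum_const, nsmul_eq_mul, mul_one] at this
      exact (abs_le.1 this).1
    have := mul_le_mul_of_nonneg_left h h0
    have h4 : (0 : ℝ) ≤ 1 + η * ∑ a ∈ B, commSign a b := by linarith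
    exact div_nonneg h4 (by positivity)
  · simp only [blockRates]
    rw [← Finset.sum_div, Finset.sum_add_distrib, ← Finset.mul_sum, Finset.sum_comm]
    have : ∑ a ∈ B, ∑ b, commSign a b = 0 := by
      refine Finset.sum_eq_zero fun a ha => ?_
      rw [sum_commSign, if_neg (ne_of_mem_of_not_mem ha hB)]
    rw [this]
    simp

/-- Orthogonality of the sign characters inverts the transform from eigenvalues to error rates. -/
lemma sum_blockRates_mul_commSign (η : ℝ) (B : Finset (PauliIdx n)) (a : PauliIdx n) :
    ∑ b, blockRates η B b * commSign a b =
      (if a = 0 then 1 else 0) + η * (if a ∈ B then 1 else 0) := by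
  have h4 : (4 : ℝ) ^ n ≠ 0 := by positivity
  have h : ∀ b, blockRates η B b * commSign a b =
      (commSign a b + η * ∑ c ∈ B, commSign c b * commSign a b) / 4 ^ n := by
    intro b
    rw [← Finset.sum_mul, blockRates]
    ring
  simp_rw [h]
  rw [← Finset.sum_div, Finset.sum_add_distrib, ← Finset.mul_sum, Finset.sum_comm, sum_commSign]
  simp_rw [sum_commSign_mul_commSign]
  rw [Finset.sum_ite_eq' B a]
  split_ifs <;> field_simp <;> ring

lemma geomFidelity_blockRates {η : ℝ} {B : Finset (PauliIdx n)} (hB : 0 ∉ B)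
    (hne : B.Nonempty) (h0 : 0 ≤ η) : geomFidelity (pauliChannel (blockRates η B)) B = η := by
  have h : ∀ b ∈ B, pauliEigenvalue (pauliChannel (blockRates η B)) b = η := by
    intro b hb
    rw [pauliEigenvalue_pauliChannel, sum_blockRates_mul_commSign, if_pos hb,
      if_neg (ne_of_mem_of_not_mem hb hB)]
    ring
  rw [geomFidelity, Finset.prod_congr rfl h, Finset.prod_const]
  have hc : B.card ≠ 0 := hne.card_ne_zero
  rcases h0.eq_or_lt with rfl | hpos
  · simp [hc]
  · rw [Real.sign_of_pos (by positivity), abs_of_pos (by positivity), one_mul, one_div,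
      Real.pow_rpow_inv_natCast h0 hc]

lemma pauliChannel_blockRates_apply (η : ℝ) {B : Finset (PauliIdx n)} (X : Op n) :
    (2 ^ n : ℂ) • pauliChannel (blockRates η B) X =
      X.trace • 1 + (η : ℂ) • ∑ b ∈ B, (pauli b * X).trace • pauli b := by
  rw [← map_smul, ← sum_trace_smul_pauli, map_sum]
  simp_rw [map_smul, pauliChannel_pauli, sum_blockRates_mul_commSign]
  have h : ∀ a : PauliIdx n, (pauli a * X).trace •
      (((if a = 0 then 1 else 0) + η * (if a ∈ B then 1 else 0) : ℝ) : ℂ) • pauli a =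
      (if a = 0 then (pauli a * X).trace • pauli a else 0) +
        (η : ℂ) • (if a ∈ B then (pauli a * X).trace • pauli a else 0) := by
    intro a
    split_ifs <;> ext i j <;>
      simp only [Matrix.add_apply, Matrix.smul_apply, Matrix.zero_apply, smul_eq_mul] <;>
      push_cast <;> ring
  simp_rw [h]
  rw [Finset.sum_add_distrib, ← Finset.smul_sum, Finset.sum_ite_eq' Finset.univ (0 : PauliIdx n),
    Finset.sum_ite_mem]
  simp [pauli_zero]

lemma trace_mul_pauliChannel_blockRates (η : ℝ) {B : Finset (PauliIdx n)} (E X : Op n) :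
    2 ^ n * (E * pauliChannel (blockRates η B) X).trace =
      E.trace * X.trace + η * ∑ b ∈ B, (pauli b * X).trace * (E * pauli b).trace := by
  have h := congrArg (fun Z => (E * Z).trace) (pauliChannel_blockRates_apply η (B := B) X)
  simpa [mul_add, Finset.mul_sum, Matrix.trace_sum, mul_comm] using h

/-! ### Traces against positive semidefinite operators -/

lemma two_pow_mul_re (k : ℕ) (z : ℂ) : (2 ^ k * z).re = 2 ^ k * z.re := by
  rw [← Complex.re_ofReal_mul]
  simp

lemma trace_re_nonneg {X : Op n} (hX : X.PosSemidef) : 0 ≤ X.trace.re :=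
  (Complex.nonneg_iff.1 hX.trace_nonneg).1

lemma trace_eq_ofReal_re {X : Op n} (hX : X.PosSemidef) : X.trace = (X.trace.re : ℂ) :=
  Complex.ext rfl (Complex.nonneg_iff.1 hX.trace_nonneg).2.symm

lemma trace_mul_eq_ofReal_re {X Y : Op n} (hX : Xᴴ = X) (hY : Yᴴ = Y) :
    (X * Y).trace = ((X * Y).trace.re : ℂ) := by
  refine (Complex.conj_eq_iff_re.1 ?_).symm
  have h := Matrix.trace_conjTranspose (X * Y)
  rw [Matrix.conjTranspose_mul, hX, hY, Matrix.trace_mul_comm] at h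
  exact h.symm

/-- A Pauli operator has expectation at most the trace in absolute value. -/
lemma abs_trace_mul_pauli_le {X : Op n} (hX : X.PosSemidef) (b : PauliIdx n) :
    |(X * pauli b).trace.re| ≤ X.trace.re := by
  -- For `s = ±1` the operator `1 + s P` is half of its own square, so its trace against `X` is
  -- nonnegative.
  have key : ∀ s : ℂ, star s = s → s * s = 1 → 0 ≤ (X.trace + s * (X * pauli b).trace).re := by
    intro s hs hss
    have h := trace_re_nonneg (hX.mul_mul_conjTranspose_same (1 + s • pauli b))
    have h1 : (1 + s • pauli b)ᴴ * (1 + s • pauli b) = (2 : ℂ) • (1 + s • pauli b) := by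
      rw [Matrix.conjTranspose_add, Matrix.conjTranspose_smul, pauli_conjTranspose, hs,
        Matrix.conjTranspose_one, add_mul, mul_add, mul_add, smul_mul_smul_comm, pauli_mul_self,
        hss, one_mul, mul_one, one_mul, one_smul, two_smul]
      abel
    rw [Matrix.mul_assoc, Matrix.trace_mul_comm, Matrix.mul_assoc, h1] at h
    rw [Matrix.mul_smul, Matrix.trace_smul, mul_add, mul_one, Matrix.mul_smul, Matrix.trace_add,
      Matrix.trace_smul, smul_eq_mul, smul_eq_mul, ← Complex.ofReal_ofNat,
      Complex.re_ofReal_mul] at h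
    linarith
  have hp := key 1 (by simp) (by simp)
  have hm := key (-1) (by simp) (by simp)
  simp only [Complex.add_re, Complex.neg_re, one_mul, neg_mul] at hp hm
  exact abs_le.2 ⟨by linarith, by linarith⟩

lemma trace_mul_self_re_le {X : Op n} (hX : X.PosSemidef) :
    (X * X).trace.re ≤ X.trace.re ^ 2 := by
  have h : (X * X).trace ≤ X.trace * X.trace := by
    simp only [Matrix.trace, Matrix.diag, Matrix.mul_apply, Finset.sum_mul_sum]
    refine Finset.sum_le_sum fun i _ => Finset.sum_le_sum fun j _ => ?_
    -- The principal `2 × 2` minor gives `|X i j|² ≤ X i i * X j j`; the case `i = j` is harmless.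
    have := (hX.submatrix ![i, j]).det_nonneg
    rw [Matrix.det_fin_two] at this
    simpa using this
  have h' := (Complex.le_def.1 h).1
  rw [trace_eq_ofReal_re hX] at h'
  simpa [sq] using h'

lemma sum_sq_trace_mul_pauli_le {X : Op n} (hX : X.PosSemidef) :
    ∑ b : PauliIdx n, (X * pauli b).trace.re ^ 2 ≤ 2 ^ n * X.trace.re ^ 2 := by
  have h := congrArg Complex.re (sum_trace_pauli_mul_trace_pauli X X)
  have h1 : ∀ b : PauliIdx n, ((pauli b * X).trace * (X * pauli b).trace).re =
      (X * pauli b).trace.re ^ 2 := by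
    intro b
    rw [Matrix.trace_mul_comm (pauli b), trace_mul_eq_ofReal_re hX.1 (pauli_conjTranspose b)]
    simp [sq]
  rw [Complex.re_sum, two_pow_mul_re] at h
  simp_rw [h1] at h
  rw [h]
  exact mul_le_mul_of_nonneg_left (trace_mul_self_re_le hX) (by positivity)

/-! ### Effects of instruments -/

lemma IsCP.posSemidef {Φ : SuperOp n} (hΦ : IsCP Φ) {X : Op n} (hX : X.PosSemidef) :
    (Φ X).PosSemidef := by
  have h := hΦ 1 (fun _ _ => X) (hX.submatrix Prod.snd)
  exact h.submatrix fun i => ((0 : Fin 1), i)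

/-- The effect of a superoperator, that is, the adjoint map applied to the identity. -/
def effect (Φ : SuperOp n) : Op n := Matrix.of fun i j => (Φ (Matrix.single j i 1)).trace

lemma trace_effect_mul (Φ : SuperOp n) (X : Op n) : (effect Φ * X).trace = (Φ X).trace := by
  conv_rhs => rw [Matrix.matrix_eq_sum_single X]
  simp only [map_sum, Matrix.trace_sum]
  rw [Finset.sum_comm]
  simp only [Matrix.trace, Matrix.diag, Matrix.mul_apply]
  refine Finset.sum_congr rfl fun i _ => Finset.sum_congr rfl fun j _ => ?_
  have h : Matrix.single j i (X j i) = X j i • Matrix.single j i (1 : ℂ) := by simp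
  rw [h, map_smul]
  simp [effect, Matrix.trace, Finset.mul_sum, mul_comm]

/-- The quadratic form at `v` is the trace of the image of a rank-one positive operator built from
`v`. Over `ℂ`, nonnegativity of the form also yields Hermiticity. -/
lemma effect_posSemidef {Φ : SuperOp n} (hΦ : IsCP Φ) : (effect Φ).PosSemidef := by
  have h : ∀ v : (Fin n → Fin 2) → ℂ, 0 ≤ star v ⬝ᵥ (effect Φ *ᵥ v) := by
    intro v
    have h := (hΦ.posSemidef (Matrix.posSemidef_vecMulVec_self_star v)).trace_nonneg
    rwa [← trace_effect_mul, Matrix.mul_vecMulVec, Matrix.trace_vecMulVec, dotProduct_comm] at h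
  rw [← Matrix.isPositive_toEuclideanLin_iff, LinearMap.isPositive_iff_complex]
  intro x
  have hx : inner ℂ ((effect Φ).toEuclideanLin x) x = star (star x.ofLp ⬝ᵥ effect Φ *ᵥ x.ofLp) := by
    rw [EuclideanSpace.inner_eq_star_dotProduct, dotProduct_comm, Matrix.star_dotProduct]
    rfl
  obtain ⟨hre, him⟩ := Complex.nonneg_iff.1 (h x.ofLp)
  rw [hx]
  exact ⟨Complex.ext (by simp) (by simp [← him]), by simpa using hre⟩

lemma sum_effect {α : Type} [Fintype α] {Φ : α → SuperOp n} (hΦ : IsTP (∑ o, Φ o)) :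
    ∑ o, effect (Φ o) = 1 := by
  ext i j
  have h := hΦ (Matrix.single j i 1)
  rw [LinearMap.sum_apply, Matrix.trace_sum] at h
  simp only [effect, Matrix.sum_apply, Matrix.of_apply, h]
  rw [Matrix.one_apply]
  split_ifs with hij
  · subst hij; simp
  · simp [Matrix.trace_single_eq_of_ne, Ne.symm hij]

lemma isPOVM_effect {α : Type} [Fintype α] {Φ : α → SuperOp n} (hΦ : IsInstrument Φ) :
    IsPOVM fun o => effect (Φ o) :=
  ⟨fun o => effect_posSemidef (hΦ.1 o), sum_effect hΦ.2⟩

/-! ### One step of the relative entropy bound -/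

/-- The information about a block of Paulis gained by a single measurement `E`. -/
def infoGain {α : Type} [Fintype α] (r : ℝ) (B : Finset (PauliIdx n)) (E : α → Op n) : ℝ :=
  r * ∑ b ∈ B, ∑ o, (E o * pauli b).trace.re ^ 2 / (2 ^ n * (E o).trace.re)

/-- The budget of one measurement: the blocks are disjoint, so their sum is at most the sum over all
Paulis. Parseval with the purity bound leaves `(E o).trace` for each outcome, and these add up to `2
^ n`. -/
lemma sum_infoGain_le {α : Type} [Fintype α] {r : ℝ} (hr : 0 ≤ r) {E : α → Op n} (hE : IsPOVM E)
    (𝓑 : Finpartition ((Finset.univ : Finset (PauliIdx n)).erase 0)) :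
    ∑ B ∈ 𝓑.parts, infoGain r B E ≤ r * 2 ^ n := by
  have hd : (0 : ℝ) < 2 ^ n := by positivity
  have hnn : ∀ b o, 0 ≤ (E o * pauli b).trace.re ^ 2 / (2 ^ n * (E o).trace.re) := fun b o =>
    div_nonneg (sq_nonneg _) (mul_nonneg hd.le (trace_re_nonneg (hE.1 o)))
  simp only [infoGain]
  rw [← Finset.mul_sum]
  refine mul_le_mul_of_nonneg_left ?_ hr
  calc ∑ B ∈ 𝓑.parts, ∑ b ∈ B, ∑ o, (E o * pauli b).trace.re ^ 2 / (2 ^ n * (E o).trace.re)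
      = ∑ b ∈ (Finset.univ : Finset (PauliIdx n)).erase 0,
          ∑ o, (E o * pauli b).trace.re ^ 2 / (2 ^ n * (E o).trace.re) := by
        exact ((Finset.sum_congr 𝓑.biUnion_parts.symm fun _ _ => rfl).trans
          (Finset.sum_biUnion 𝓑.disjoint)).symm
    _ ≤ ∑ b : PauliIdx n, ∑ o, (E o * pauli b).trace.re ^ 2 / (2 ^ n * (E o).trace.re) :=
        Finset.sum_le_sum_of_subset_of_nonneg (Finset.erase_subset _ _)
          fun b _ _ => Finset.sum_nonneg fun o _ => hnn b o
    _ = ∑ o, (∑ b : PauliIdx n, (E o * pauli b).trace.re ^ 2) / (2 ^ n * (E o).trace.re) := by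
        rw [Finset.sum_comm]
        simp_rw [Finset.sum_div]
    _ ≤ ∑ o, (E o).trace.re := by
        refine Finset.sum_le_sum fun o _ => ?_
        have h0 := trace_re_nonneg (hE.1 o)
        refine div_le_of_le_mul₀ (by positivity) h0 ?_
        linarith [sum_sq_trace_mul_pauli_le (hE.1 o)]
    _ = 2 ^ n := by
        rw [← Complex.re_sum, ← Matrix.trace_sum, hE.2, Matrix.trace_one, Complex.natCast_re]
        simp

/-- Each branch rescales the trace by a constant, so its effect has no component along a traceless
Pauli. -/
lemma infoGain_effect_of_isTrivialInstrument {α : Type} [Fintype α] {Φ : α → SuperOp n}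
    (hΦ : IsTrivialInstrument Φ) (r : ℝ) {B : Finset (PauliIdx n)} (hB : 0 ∉ B) :
    infoGain r B (fun o => effect (Φ o)) = 0 := by
  rw [infoGain, Finset.sum_eq_zero, mul_zero]
  refine fun b hb => Finset.sum_eq_zero fun o _ => ?_
  obtain ⟨s, Ψ, -, hΨ, h⟩ := hΦ o
  rw [trace_effect_mul, h, LinearMap.smul_apply, Matrix.trace_smul, hΨ,
    trace_pauli (ne_of_mem_of_not_mem hb hB)]
  simp

lemma neg_log_one_add_le {x : ℝ} (hx : |x| ≤ 1 / 2) : -Real.log (1 + x) ≤ -x + 2 * x ^ 2 := by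
  have h := Real.abs_log_sub_add_sum_range_le (x := -x) (by rw [abs_neg]; linarith) 1
  simp only [Finset.sum_range_one, abs_neg, sub_neg_eq_add, Nat.cast_zero, zero_add, pow_one,
    div_one, one_add_one_eq_two, sq_abs] at h
  have h2 : x ^ 2 / (1 - |x|) ≤ 2 * x ^ 2 := by
    rw [div_le_iff₀ (by linarith)]
    nlinarith [sq_nonneg x]
  linarith [(abs_le.1 h).1]

/-- Likelihood ratio of the outcomes of a POVM after the two channels, and its contribution to the
relative entropy. -/
lemma exists_likelihood_ratio {α : Type} [Fintype α] {E : α → Op n} (hE : IsPOVM E)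
    {η : ℝ} {C : ℕ} {B : Finset (PauliIdx n)} (hB : 0 ∉ B) (hBC : B.card ≤ C) (h0 : 0 ≤ η)
    (hη : η * C ≤ 1 / 2) {σ : Op n} (hσ : σ.PosSemidef) :
    ∃ L : α → ℝ, (∀ o, 0 < L o) ∧
      (∀ o, (E o * pauliChannel (blockRates η B) σ).trace.re =
        σ.trace.re * ((E o).trace.re / 2 ^ n * L o)) ∧
      ∑ o, (E o).trace.re / 2 ^ n * -Real.log (L o) ≤ infoGain (2 * η ^ 2 * C) B E := by
  have hd : (0 : ℝ) < 2 ^ n := by positivity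
  set u : PauliIdx n → ℝ := fun b => (σ * pauli b).trace.re / σ.trace.re with hu
  have hu1 : ∀ b, |u b| ≤ 1 := fun b => by
    rw [hu, abs_div, abs_of_nonneg (trace_re_nonneg hσ)]
    exact div_le_one_of_le₀ (abs_trace_mul_pauli_le hσ b) (trace_re_nonneg hσ)
  set v : α → PauliIdx n → ℝ := fun o b => (E o * pauli b).trace.re / (E o).trace.re with hv
  have hv1 : ∀ o b, |v o b| ≤ 1 := fun o b => by
    rw [hv, abs_div, abs_of_nonneg (trace_re_nonneg (hE.1 o))]
    exact div_le_one_of_le₀ (abs_trace_mul_pauli_le (hE.1 o) b) (trace_re_nonneg (hE.1 o))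
  -- When the trace vanishes, `u b` is zero by the division convention; the numerator vanishes too,
  -- being bounded by the trace.
  have huσ : ∀ b, (σ * pauli b).trace.re = σ.trace.re * u b := fun b => by
    have := abs_trace_mul_pauli_le hσ b
    by_cases h : σ.trace.re = 0
    · rw [h, zero_mul]
      exact abs_nonpos_iff.1 (h ▸ this)
    · rw [hu]; field_simp
  have hvE : ∀ o b, (E o * pauli b).trace.re = (E o).trace.re * v o b := fun o b => by
    have := abs_trace_mul_pauli_le (hE.1 o) b
    by_cases h : (E o).trace.re = 0
    · rw [h, zero_mul]
      exact abs_nonpos_iff.1 (h ▸ this)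
    · rw [hv]; field_simp
  set δ : α → ℝ := fun o => η * ∑ b ∈ B, u b * v o b with hδ
  have hδ1 : ∀ o, |δ o| ≤ 1 / 2 := by
    intro o
    have h1 : |∑ b ∈ B, u b * v o b| ≤ C := by
      refine (Finset.abs_sum_le_sum_abs _ _).trans ?_
      have : ∑ b ∈ B, |u b * v o b| ≤ ∑ b ∈ B, 1 := Finset.sum_le_sum fun b _ => by
        rw [abs_mul]
        exact mul_le_one₀ (hu1 b) (abs_nonneg _) (hv1 o b)
      refine this.trans ?_
      simpa using hBC
    rw [hδ, abs_mul, abs_of_nonneg h0]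
    exact (mul_le_mul_of_nonneg_left h1 h0).trans hη
  -- The first-order term vanishes: the effects sum to `1` and every Pauli in `B` is traceless.
  have hsum : ∑ o, (E o).trace.re / 2 ^ n * δ o = 0 := by
    have h1 : ∀ o, (E o).trace.re / 2 ^ n * δ o =
        ∑ b ∈ B, η / 2 ^ n * u b * (E o * pauli b).trace.re := by
      intro o
      simp only [hδ, Finset.mul_sum, hvE]
      exact Finset.sum_congr rfl fun b _ => by ring
    simp_rw [h1]
    rw [Finset.sum_comm]
    refine Finset.sum_eq_zero fun b hb => ?_
    rw [← Finset.mul_sum, ← Complex.re_sum, ← Matrix.trace_sum, ← Finset.sum_mul, hE.2, one_mul,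
      trace_pauli (ne_of_mem_of_not_mem hb hB)]
    simp
  have hsq : ∀ o, (E o).trace.re / 2 ^ n * (2 * δ o ^ 2) ≤
      2 * η ^ 2 * C * ∑ b ∈ B, (E o * pauli b).trace.re ^ 2 / (2 ^ n * (E o).trace.re) := by
    intro o
    have hE0 := trace_re_nonneg (hE.1 o)
    -- Cauchy–Schwarz with `|u b| ≤ 1` discards the state at the price of a factor `C`.
    have h1 : (∑ b ∈ B, u b * v o b) ^ 2 ≤ C * ∑ b ∈ B, v o b ^ 2 := by
      refine (Finset.sum_mul_sq_le_sq_mul_sq B u (v o)).trans ?_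
      refine mul_le_mul_of_nonneg_right ?_ (Finset.sum_nonneg fun _ _ => sq_nonneg _)
      have : ∑ b ∈ B, u b ^ 2 ≤ ∑ b ∈ B, 1 :=
        Finset.sum_le_sum fun b _ => (sq_le_one_iff_abs_le_one _).2 (hu1 b)
      refine this.trans ?_
      simpa using hBC
    have h2 : ∀ b, (E o * pauli b).trace.re ^ 2 / (2 ^ n * (E o).trace.re) =
        (E o).trace.re / 2 ^ n * v o b ^ 2 := by
      intro b
      rw [hvE]
      by_cases h : (E o).trace.re = 0
      · simp [h]
      · field_simp
    simp_rw [h2]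
    rw [← Finset.mul_sum, hδ, mul_pow]
    have h3 := mul_le_mul_of_nonneg_left h1
      (mul_nonneg (div_nonneg hE0 hd.le) (sq_nonneg η))
    linarith
  refine ⟨fun o => 1 + δ o, fun o => ?_, fun o => ?_, ?_⟩
  · linarith [(abs_le.1 (hδ1 o)).1]
  · have h := congrArg Complex.re (trace_mul_pauliChannel_blockRates η (B := B) (E o) σ)
    have h3 : ∀ b, (pauli b * σ).trace * (E o * pauli b).trace =
        ((σ.trace.re * u b * ((E o).trace.re * v o b) : ℝ) : ℂ) := fun b => by
      rw [Matrix.trace_mul_comm, trace_mul_eq_ofReal_re hσ.1 (pauli_conjTranspose b),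
        trace_mul_eq_ofReal_re (hE.1 o).1 (pauli_conjTranspose b), huσ, hvE, ← Complex.ofReal_mul]
    rw [Finset.sum_congr rfl fun b _ => h3 b, two_pow_mul_re, ← Complex.ofReal_sum,
      trace_eq_ofReal_re hσ, trace_eq_ofReal_re (hE.1 o), ← Complex.ofReal_mul,
      ← Complex.ofReal_mul, ← Complex.ofReal_add, Complex.ofReal_re] at h
    simp only [Complex.ofReal_re] at h
    have h4 : ∑ b ∈ B, σ.trace.re * u b * ((E o).trace.re * v o b) =
        σ.trace.re * (E o).trace.re * ∑ b ∈ B, u b * v o b := by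
      rw [Finset.mul_sum]
      exact Finset.sum_congr rfl fun b _ => by ring
    rw [h4] at h
    simp only [hδ]
    field_simp
    linarith
  · calc ∑ o, (E o).trace.re / 2 ^ n * -Real.log (1 + δ o)
        ≤ ∑ o, (E o).trace.re / 2 ^ n * (-δ o + 2 * δ o ^ 2) :=
          Finset.sum_le_sum fun o _ => mul_le_mul_of_nonneg_left (neg_log_one_add_le (hδ1 o))
            (div_nonneg (trace_re_nonneg (hE.1 o)) hd.le)
      _ = ∑ o, (E o).trace.re / 2 ^ n * (2 * δ o ^ 2) := by
          simp_rw [mul_add, mul_neg]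
          rw [Finset.sum_add_distrib, Finset.sum_neg_distrib, hsum, neg_zero, zero_add]
      _ ≤ _ := (Finset.sum_le_sum fun o _ => hsq o).trans_eq (by
          rw [infoGain, Finset.sum_comm, Finset.mul_sum])

lemma trace_mul_pauliChannel_blockRates_zero {E σ : Op n} (hE : E.PosSemidef) (hσ : σ.PosSemidef)
    (B : Finset (PauliIdx n)) :
    (E * pauliChannel (blockRates 0 B) σ).trace.re = σ.trace.re * (E.trace.re / 2 ^ n) := by
  have h := congrArg Complex.re (trace_mul_pauliChannel_blockRates 0 (B := B) E σ)
  rw [two_pow_mul_re, trace_eq_ofReal_re hσ, trace_eq_ofReal_re hE] at h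
  simp at h
  field_simp
  linarith

/-! ### Relative entropy of adaptive measurements -/

lemma blockRates_zero (B B' : Finset (PauliIdx n)) : blockRates 0 B = blockRates 0 B' := by
  funext b
  simp [blockRates]

/-- Chain rule: extending a likelihood ratio by one adaptively chosen measurement. -/
lemma exists_likelihood_ratio_extend {H α : Type} [Fintype H] [Fintype α] {E : H → α → Op n}
    (hE : ∀ h, IsPOVM (E h)) {η : ℝ} {C : ℕ} {B : Finset (PauliIdx n)} (hB : 0 ∉ B)
    (hBC : B.card ≤ C) (h0 : 0 ≤ η) (hη : η * C ≤ 1 / 2) {σ₀ σ : H → Op n}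
    (hσ₀ : ∀ h, (σ₀ h).PosSemidef) (hσ : ∀ h, (σ h).PosSemidef) {L D : H → ℝ}
    (hL : ∀ h, 0 < L h) (hr : ∀ h, (σ h).trace.re = (σ₀ h).trace.re * L h)
    (hD : ∑ h, (σ₀ h).trace.re * -Real.log (L h) ≤ ∑ h, (σ₀ h).trace.re * D h) :
    ∃ L' : H → α → ℝ, (∀ h o, 0 < L' h o) ∧
      (∀ h o, (E h o * pauliChannel (blockRates η B) (σ h)).trace.re =
        (E h o * pauliChannel (blockRates 0 ∅) (σ₀ h)).trace.re * L' h o) ∧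
      ∑ h, ∑ o, (E h o * pauliChannel (blockRates 0 ∅) (σ₀ h)).trace.re * -Real.log (L' h o) ≤
        ∑ h, ∑ o, (E h o * pauliChannel (blockRates 0 ∅) (σ₀ h)).trace.re *
          (D h + infoGain (2 * η ^ 2 * C) B (E h)) := by
  -- The factor `K h` depends on the state reached under the alternative, but the bound on its mean
  -- logarithm does not.
  choose K hK0 hK hKsum using fun h => exists_likelihood_ratio (hE h) hB hBC h0 hη (hσ h)
  have hnull : ∀ h o, (E h o * pauliChannel (blockRates 0 ∅) (σ₀ h)).trace.re =
      (σ₀ h).trace.re * ((E h o).trace.re / 2 ^ n) := fun h o =>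
    trace_mul_pauliChannel_blockRates_zero ((hE h).1 o) (hσ₀ h) ∅
  have hsum : ∀ h, ∑ o, (E h o).trace.re / 2 ^ n = 1 := fun h => by
    rw [← Finset.sum_div, ← Complex.re_sum, ← Matrix.trace_sum, (hE h).2, Matrix.trace_one,
      Complex.natCast_re]
    simp
  refine ⟨fun h o => L h * K h o, fun h o => mul_pos (hL h) (hK0 h o), fun h o => ?_, ?_⟩
  · rw [hK, hnull, hr]
    ring
  · have hlog : ∀ h, ∑ o, (E h o * pauliChannel (blockRates 0 ∅) (σ₀ h)).trace.re *
        -Real.log (L h * K h o) = (σ₀ h).trace.re * -Real.log (L h) +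
          (σ₀ h).trace.re * ∑ o, (E h o).trace.re / 2 ^ n * -Real.log (K h o) := by
      intro h
      have : ∀ o, (E h o * pauliChannel (blockRates 0 ∅) (σ₀ h)).trace.re *
          -Real.log (L h * K h o) =
          (σ₀ h).trace.re * -Real.log (L h) * ((E h o).trace.re / 2 ^ n) +
            (σ₀ h).trace.re * ((E h o).trace.re / 2 ^ n * -Real.log (K h o)) := fun o => by
        rw [hnull, Real.log_mul (hL h).ne' (hK0 h o).ne']
        ring
      simp_rw [this]
      rw [Finset.sum_add_distrib, ← Finset.mul_sum, ← Finset.mul_sum, hsum, mul_one]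
    have hgain : ∀ h, ∑ o, (E h o * pauliChannel (blockRates 0 ∅) (σ₀ h)).trace.re *
        (D h + infoGain (2 * η ^ 2 * C) B (E h)) =
          (σ₀ h).trace.re * D h + (σ₀ h).trace.re * infoGain (2 * η ^ 2 * C) B (E h) := by
      intro h
      simp_rw [hnull]
      rw [← Finset.sum_mul, ← Finset.mul_sum, hsum]
      ring
    simp_rw [hlog, hgain]
    rw [Finset.sum_add_distrib, Finset.sum_add_distrib]
    exact add_le_add hD (Finset.sum_le_sum fun h _ =>
      mul_le_mul_of_nonneg_left (hKsum h) (trace_re_nonneg (hσ₀ h)))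

lemma sum_history_succ {A : ℕ → Type} [∀ i, Fintype (A i)] {M : Type*} [AddCommMonoid M] (t : ℕ)
    (F : History A t → A t → M) :
    ∑ o : History A (t + 1), F (o.take t (Nat.le_succ t)) (o (Fin.last t)) =
      ∑ h, ∑ a, F h a := by
  rw [← Fintype.sum_prod_type', ← (Equiv.prodComm _ _).sum_comp]
  refine (Fintype.sum_equiv (Fin.snocEquiv fun i : Fin (t + 1) => A i) _ _ fun x => ?_).symm
  have h1 : History.take (A := A) (Fin.snocEquiv (fun i : Fin (t + 1) => A i) x) t
      (Nat.le_succ t) = x.2 := by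
    funext i
    exact Fin.snoc_castSucc (α := fun i : Fin (t + 1) => A i) x.1 x.2 i
  have h2 : (Fin.snocEquiv (fun i : Fin (t + 1) => A i) x) (Fin.last t) = x.1 :=
    Fin.snoc_last (α := fun i : Fin (t + 1) => A i) x.1 x.2
  rw [h1, h2]
  rfl

/-- Cumulative information gain about a block from the instruments along an outcome string. -/
def Scheme.gain {m : ℕ} (S : Scheme n m) (r : ℝ) (B : Finset (PauliIdx n)) (t : ℕ)
    (o : History S.A (t + 1)) : ℝ :=
  ∑ s : Fin (t + 1), if 1 ≤ (s : ℕ) then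
    infoGain r B (fun a => effect (S.instr s (o.take s s.isLt.le) a)) else 0

/-! ### Outcome laws and likelihood ratios of a scheme -/

namespace Scheme

variable {m : ℕ} (S : Scheme n m)

lemma state_posSemidef {p : PauliIdx n → ℝ} (hp : p ∈ stdSimplex ℝ (PauliIdx n)) :
    ∀ (t : ℕ), t ≤ m → ∀ o, (S.state (pauliChannel p) t o).PosSemidef
  | 0, _, _ => S.init_ensemble.1 _
  | t + 1, ht, _ => ((S.instr_instrument (t + 1) (Nat.le_add_left 1 t) ht _).1 _).posSemidef
      (pauliChannel_posSemidef hp (state_posSemidef hp t (Nat.le_of_succ_le ht) _))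

lemma sum_trace_state {Λ : SuperOp n} (hΛ : IsTP Λ) :
    ∀ (t : ℕ), t ≤ m → ∑ o, (S.state Λ t o).trace = 1
  | 0, _ => by
      have h := sum_history_succ (A := S.A) 0 fun _ a => (S.init a).trace
      simp only [state]
      refine h.trans ?_
      rw [Fintype.sum_unique, ← Matrix.trace_sum]
      exact S.init_ensemble.2
  | t + 1, ht => by
      have h := sum_history_succ (A := S.A) (t + 1)
        fun h a => (S.instr (t + 1) h a (Λ (S.state Λ t h))).trace
      simp only [state]
      refine h.trans ?_
      rw [← sum_trace_state hΛ t (Nat.le_of_succ_le ht)]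
      refine Finset.sum_congr rfl fun h _ => ?_
      have hTP := (S.instr_instrument (t + 1) (Nat.le_add_left 1 t) ht h).2 (Λ (S.state Λ t h))
      rw [LinearMap.sum_apply, Matrix.trace_sum] at hTP
      rw [hTP, hΛ]

lemma sum_prob {Λ : SuperOp n} (hΛ : IsTP Λ) : ∑ o, S.prob Λ o = 1 := by
  have h := sum_history_succ (A := S.A) (m + 1)
    fun h a => (S.povm h a * Λ (S.state Λ m h)).trace.re
  simp only [prob]
  refine h.trans ?_
  have h1 : ∀ h, ∑ a, (S.povm h a * Λ (S.state Λ m h)).trace.re = (S.state Λ m h).trace.re := by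
    intro h
    rw [← Complex.re_sum, ← Matrix.trace_sum, ← Finset.sum_mul, (S.povm_povm h).2, one_mul, hΛ]
  simp_rw [h1]
  rw [← Complex.re_sum, S.sum_trace_state hΛ m le_rfl, Complex.one_re]

lemma exists_likelihood_ratio_state {η : ℝ} {C : ℕ} {B : Finset (PauliIdx n)} (hB : 0 ∉ B)
    (hBC : B.card ≤ C) (h0 : 0 ≤ η) (hη : η * C ≤ 1 / 2)
    (hp : blockRates η B ∈ stdSimplex ℝ (PauliIdx n))
    (hp₀ : blockRates 0 ∅ ∈ stdSimplex ℝ (PauliIdx n)) :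
    ∀ t, t ≤ m → ∃ L : History S.A (t + 1) → ℝ, (∀ o, 0 < L o) ∧
      (∀ o, (S.state (pauliChannel (blockRates η B)) t o).trace.re =
        (S.state (pauliChannel (blockRates 0 ∅)) t o).trace.re * L o) ∧
      ∑ o, (S.state (pauliChannel (blockRates 0 ∅)) t o).trace.re * -Real.log (L o) ≤
        ∑ o, (S.state (pauliChannel (blockRates 0 ∅)) t o).trace.re *
          S.gain (2 * η ^ 2 * C) B t o
  -- The initial state precedes every use of the channel, so both laws agree and index `0`
  -- contributes no gain.
  | 0, _ => ⟨fun _ => 1, fun _ => one_pos, fun o => by simp [state], by simp [gain]⟩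
  | t + 1, ht => by
      have ht' := Nat.le_of_succ_le ht
      obtain ⟨L, hL, hr, hD⟩ := exists_likelihood_ratio_state hB hBC h0 hη hp hp₀ t ht'
      have hI := S.instr_instrument (t + 1) (Nat.le_add_left 1 t) ht
      obtain ⟨L', hL', hr', hD'⟩ := exists_likelihood_ratio_extend
        (fun h => isPOVM_effect (hI h)) hB hBC h0 hη (S.state_posSemidef hp₀ t ht')
        (S.state_posSemidef hp t ht') hL hr hD
      simp only [trace_effect_mul] at hr' hD'
      refine ⟨fun o => L' (o.take (t + 1) (Nat.le_succ _)) (o (Fin.last (t + 1))),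
        fun o => hL' _ _, fun o => hr' _ _, ?_⟩
      have h1 := sum_history_succ (A := S.A) (t + 1) fun h a =>
        (S.instr (t + 1) h a (pauliChannel (blockRates 0 ∅)
          (S.state (pauliChannel (blockRates 0 ∅)) t h))).trace.re * -Real.log (L' h a)
      have h2 := sum_history_succ (A := S.A) (t + 1) fun h a =>
        (S.instr (t + 1) h a (pauliChannel (blockRates 0 ∅)
          (S.state (pauliChannel (blockRates 0 ∅)) t h))).trace.re *
            (S.gain (2 * η ^ 2 * C) B t h +
              infoGain (2 * η ^ 2 * C) B fun a => effect (S.instr (t + 1) h a))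
      rw [← h1, ← h2] at hD'
      refine hD'.trans_eq (Finset.sum_congr rfl fun o _ => ?_)
      congr 1
      symm
      rw [gain, Fin.sum_univ_castSucc]
      exact congrArg₂ (· + ·) rfl (if_pos (Nat.le_add_left 1 t))

lemma exists_likelihood_ratio_prob {η : ℝ} {C : ℕ} {B : Finset (PauliIdx n)} (hB : 0 ∉ B)
    (hBC : B.card ≤ C) (h0 : 0 ≤ η) (hη : η * C ≤ 1 / 2)
    (hp : blockRates η B ∈ stdSimplex ℝ (PauliIdx n))
    (hp₀ : blockRates 0 ∅ ∈ stdSimplex ℝ (PauliIdx n)) :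
    ∃ L : S.Outcome → ℝ, (∀ o, 0 < L o) ∧
      (∀ o, S.prob (pauliChannel (blockRates η B)) o =
        S.prob (pauliChannel (blockRates 0 ∅)) o * L o) ∧
      ∑ o, S.prob (pauliChannel (blockRates 0 ∅)) o * -Real.log (L o) ≤
        ∑ o : S.Outcome, S.prob (pauliChannel (blockRates 0 ∅)) o *
          (S.gain (2 * η ^ 2 * C) B m (o.take (m + 1) (Nat.le_succ _)) +
            infoGain (2 * η ^ 2 * C) B (S.povm (o.take (m + 1) (Nat.le_succ _)))) := by
  obtain ⟨L, hL, hr, hD⟩ := S.exists_likelihood_ratio_state hB hBC h0 hη hp hp₀ m le_rfl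
  obtain ⟨L', hL', hr', hD'⟩ := exists_likelihood_ratio_extend S.povm_povm hB hBC h0 hη
    (S.state_posSemidef hp₀ m le_rfl) (S.state_posSemidef hp m le_rfl) hL hr hD
  refine ⟨fun o => L' (o.take (m + 1) (Nat.le_succ _)) (o (Fin.last (m + 1))),
    fun o => hL' _ _, fun o => hr' _ _, ?_⟩
  have h1 := sum_history_succ (A := S.A) (m + 1) fun h a =>
    (S.povm h a * pauliChannel (blockRates 0 ∅)
      (S.state (pauliChannel (blockRates 0 ∅)) m h)).trace.re * -Real.log (L' h a)
  have h2 := sum_history_succ (A := S.A) (m + 1) fun h a =>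
    (S.povm h a * pauliChannel (blockRates 0 ∅)
      (S.state (pauliChannel (blockRates 0 ∅)) m h)).trace.re *
        (S.gain (2 * η ^ 2 * C) B m h + infoGain (2 * η ^ 2 * C) B (S.povm h))
  rw [← h1, ← h2] at hD'
  exact hD'

/-! ### Information budget of a scheme and the two-point test -/

lemma prob_null_nonneg (hp₀ : blockRates 0 ∅ ∈ stdSimplex ℝ (PauliIdx n)) (o : S.Outcome) :
    0 ≤ S.prob (pauliChannel (blockRates 0 ∅)) o := by
  have hσ := S.state_posSemidef hp₀ m le_rfl (o.take (m + 1) (Nat.le_succ _))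
  have hE := (S.povm_povm (o.take (m + 1) (Nat.le_succ _))).1 (o (Fin.last (m + 1)))
  rw [prob, trace_mul_pauliChannel_blockRates_zero hE hσ]
  exact mul_nonneg (trace_re_nonneg hσ) (div_nonneg (trace_re_nonneg hE) (by positivity))

-- Holds along every single outcome string, so no averaging is needed: each nontrivial instrument
-- and the final POVM cost at most one measurement budget, and trivial instruments are free.
open Classical in
lemma sum_gain_le {r : ℝ} (hr : 0 ≤ r)
    (𝓑 : Finpartition ((Finset.univ : Finset (PauliIdx n)).erase 0))
    (o : History S.A (m + 1)) :
    ∑ B ∈ 𝓑.parts, (S.gain r B m o + infoGain r B (S.povm o)) ≤ r * 2 ^ n * S.numMeas := by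
  have h0 : ∀ B ∈ 𝓑.parts, (0 : PauliIdx n) ∉ B := fun B hB h =>
    Finset.notMem_erase 0 _ (𝓑.le hB h)
  have hcount := Finset.le_sup (f := fun o : History S.A (m + 1) =>
    ((Finset.univ : Finset (Fin (m + 1))).filter fun t : Fin (m + 1) =>
      1 ≤ (t : ℕ) ∧ ¬ IsTrivialInstrument (S.instr t (o.take (t : ℕ) t.isLt.le))).card + 1)
    (Finset.mem_univ o)
  have hcount' : ((((Finset.univ : Finset (Fin (m + 1))).filter fun t : Fin (m + 1) =>
      1 ≤ (t : ℕ) ∧ ¬ IsTrivialInstrument (S.instr t (o.take (t : ℕ) t.isLt.le))).card : ℕ) : ℝ)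
        + 1 ≤ S.numMeas := by
    exact_mod_cast hcount
  have hr2 : 0 ≤ r * 2 ^ n := by positivity
  have hgain : ∑ B ∈ 𝓑.parts, S.gain r B m o ≤ r * 2 ^ n *
      ((Finset.univ : Finset (Fin (m + 1))).filter fun t : Fin (m + 1) =>
        1 ≤ (t : ℕ) ∧ ¬ IsTrivialInstrument (S.instr t (o.take (t : ℕ) t.isLt.le))).card := by
    simp only [gain]
    rw [Finset.sum_comm, Finset.card_filter, Nat.cast_sum, Finset.mul_sum]
    refine Finset.sum_le_sum fun s _ => ?_
    by_cases hs : 1 ≤ (s : ℕ)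
    · by_cases htriv : IsTrivialInstrument (S.instr s (o.take (s : ℕ) s.isLt.le))
      · rw [if_neg (fun h => h.2 htriv), Nat.cast_zero, mul_zero]
        refine (Finset.sum_eq_zero fun B hB => ?_).le
        rw [if_pos hs, infoGain_effect_of_isTrivialInstrument htriv r (h0 B hB)]
      · rw [if_pos ⟨hs, htriv⟩, Nat.cast_one, mul_one]
        simp only [hs, if_true]
        exact sum_infoGain_le hr (isPOVM_effect
          (S.instr_instrument s hs (Nat.le_of_lt_succ s.isLt) _)) 𝓑
    · simp [hs]
  rw [Finset.sum_add_distrib]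
  have hlast := sum_infoGain_le hr (S.povm_povm o) 𝓑
  have := mul_le_mul_of_nonneg_left hcount' hr2
  linarith

open Classical in
/-- The relative entropy needed to tell the null channel from the channel of the block `B`. -/
lemma one_div_nine_le_relative_entropy
    {𝓑 : Finset (Finset (PauliIdx n))} {est : Finset (PauliIdx n) → S.Outcome → ℝ} {ε : ℝ}
    (hε : 0 < ε) (hS : S.Learns 𝓑 est ε) {B : Finset (PauliIdx n)} (hB𝓑 : B ∈ 𝓑) (hB : 0 ∉ B)
    (hne : B.Nonempty)
    (hp : blockRates (3 * ε) B ∈ stdSimplex ℝ (PauliIdx n))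
    (hp₀ : blockRates 0 ∅ ∈ stdSimplex ℝ (PauliIdx n))
    {L : S.Outcome → ℝ} (hL : ∀ o, 0 < L o)
    (hr : ∀ o, S.prob (pauliChannel (blockRates (3 * ε) B)) o =
      S.prob (pauliChannel (blockRates 0 ∅)) o * L o) :
    1 / 9 ≤ ∑ o, S.prob (pauliChannel (blockRates 0 ∅)) o * -Real.log (L o) := by
  set P := S.prob (pauliChannel (blockRates 0 ∅)) with hP
  set Q := S.prob (pauliChannel (blockRates (3 * ε) B)) with hQ
  have hP0 : ∀ o, 0 ≤ P o := S.prob_null_nonneg hp₀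
  have hQ0 : ∀ o, 0 ≤ Q o := fun o => by
    rw [hr]
    exact mul_nonneg (hP0 o) (hL o).le
  have hP1 : ∑ o, P o = 1 := S.sum_prob (pauliChannel_isTP hp₀)
  have hQ1 : ∑ o, Q o = 1 := S.sum_prob (pauliChannel_isTP hp)
  set s : Set S.Outcome := {o | |est B o| ≤ ε} with hs
  have hPs : 2 / 3 ≤ ∑ o, if o ∈ s then P o else 0 := by
    have h := hS _ hp₀ B hB𝓑
    -- At `η = 0` the block is irrelevant, so the null channel may be read as the channel of `B`
    -- with fidelity `0`.
    rw [blockRates_zero ∅ B, geomFidelity_blockRates hB hne le_rfl, blockRates_zero B ∅] at h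
    simp only [sub_zero] at h
    exact h
  have hQs : (∑ o, if o ∈ s then Q o else 0) ≤ 1 / 3 := by
    have h := hS _ hp B hB𝓑
    rw [geomFidelity_blockRates hB hne (by positivity), probEvent] at h
    -- Estimates within `ε` of `0` and within `ε` of `3 * ε` are disjoint events.
    have h2 : (∑ o, if o ∈ s then Q o else 0) +
        (∑ o, if o ∈ {o | |est B o - 3 * ε| ≤ ε} then Q o else 0) ≤ ∑ o, Q o := by
      rw [← Finset.sum_add_distrib]
      refine Finset.sum_le_sum fun o _ => ?_
      simp only [hs, Set.mem_ofPred_eq]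
      split_ifs with h1 h2 h2
      · have := (abs_le.1 h1).2
        have := (abs_le.1 h2).1
        linarith
      · simp
      · simp
      · simpa using hQ0 o
    linarith
  -- Tangent bound `log (w * L) ≤ w * L - 1`, with weight `w = 4 / 3` on `s` and `2 / 3` off it.
  -- Summed, the non-logarithmic part is at least `1 - 2 / 3 - 2 / 9 = 1 / 9`.
  have hpt : ∀ o, P o * Real.log (2 / 3) + Real.log 2 * (if o ∈ s then P o else 0) + P o -
      (2 / 3 * Q o + 2 / 3 * (if o ∈ s then Q o else 0)) ≤ P o * -Real.log (L o) := by
    intro o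
    have key : ∀ w : ℝ, 0 < w → P o * Real.log w + P o - w * Q o ≤ P o * -Real.log (L o) := by
      intro w hw
      have h := Real.log_le_sub_one_of_pos (mul_pos hw (hL o))
      rw [Real.log_mul hw.ne' (hL o).ne'] at h
      have := mul_le_mul_of_nonneg_left h (hP0 o)
      rw [hr]
      linarith
    split_ifs
    · have h := key (4 / 3) (by norm_num)
      have : Real.log (4 / 3) = Real.log (2 / 3) + Real.log 2 := by
        rw [← Real.log_mul (by norm_num) (by norm_num)]
        norm_num
      rw [this] at h
      linarith
    · have h := key (2 / 3) (by norm_num)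
      linarith
  have hsum := Finset.sum_le_sum fun o (_ : o ∈ Finset.univ) => hpt o
  rw [Finset.sum_sub_distrib, Finset.sum_add_distrib, Finset.sum_add_distrib,
    Finset.sum_add_distrib, ← Finset.sum_mul, ← Finset.mul_sum, ← Finset.mul_sum,
    ← Finset.mul_sum, hP1, hQ1] at hsum
  have hlog2 : 0 ≤ Real.log 2 := Real.log_nonneg (by norm_num)
  -- The remaining logarithms combine to `log (32 / 27) / 3`, which is nonnegative.
  have hlog : 0 ≤ 3 * Real.log (2 / 3) + 2 * Real.log 2 := by
    have h : 3 * Real.log (2 / 3) + 2 * Real.log 2 = Real.log ((2 / 3) ^ 3 * 2 ^ 2) := by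
      rw [Real.log_mul (by norm_num) (by norm_num), Real.log_pow, Real.log_pow]
      norm_num
    rw [h]
    exact Real.log_nonneg (by norm_num)
  have := mul_le_mul_of_nonneg_left hPs hlog2
  linarith

end Scheme

/-! ### Counting blocks and conclusion -/

lemma three_mul_four_pow_le_card_parts {C : ℕ} (hn : 1 ≤ n)
    (𝓑 : Finpartition ((Finset.univ : Finset (PauliIdx n)).erase 0))
    (hC : ∀ B ∈ 𝓑.parts, B.card ≤ C) : 3 * (2 ^ n * 2 ^ n : ℝ) ≤ 4 * (𝓑.parts.card * C) := by
  have h1 : ∑ B ∈ 𝓑.parts, B.card ≤ 𝓑.parts.card * C := by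
    simpa using Finset.sum_le_card_nsmul _ _ _ hC
  rw [𝓑.sum_card_parts, Finset.card_erase_of_mem (Finset.mem_univ _), Finset.card_univ] at h1
  have hcard : Fintype.card (PauliIdx n) = 4 ^ n := by simp
  rw [hcard] at h1
  have h4 : 4 ≤ 4 ^ n := by simpa using Nat.pow_le_pow_right (show 0 < 4 by norm_num) hn
  have h2 : 3 * 4 ^ n ≤ 4 * (𝓑.parts.card * C) := by omega
  rw [← mul_pow, show (2 * 2 : ℝ) = 4 by norm_num]
  exact_mod_cast h2

end PauliLearning

end

open PauliLearning in
theorem theorem2 :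
    ∃ c : ℝ, 0 < c ∧
      ∀ (n : ℕ), 1 ≤ n →
      ∀ (𝓑 : Finpartition ((Finset.univ : Finset (PauliIdx n)).erase 0))
        (C : ℕ), (∀ B ∈ 𝓑.parts, B.card ≤ C) →
      ∀ (ε : ℝ), 0 < ε → ε ≤ 1 / (6 * (C : ℝ)) →
      ∀ (m : ℕ) (S : Scheme n m) (est : Finset (PauliIdx n) → S.Outcome → ℝ),
        S.Learns 𝓑.parts est ε →
          c * (2 ^ n / (ε ^ 2 * (C : ℝ) ^ 2)) ≤ (S.numMeas : ℝ) := by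
  -- The inequality `(3 / 4) * 4 ^ n / C * (1 / 9) ≤ 18 * ε ^ 2 * C * 2 ^ n * N` rearranges to this
  -- constant.
  refine ⟨1 / 216, by norm_num, ?_⟩
  intro n hn 𝓑 C hC ε hε hεC m S est hS
  -- For `C = 0` the upper bound on `ε` reads `ε ≤ 0`, since division by zero gives zero.
  have hC0 : (0 : ℝ) < C := by
    rcases Nat.eq_zero_or_pos C with rfl | h
    · simp only [Nat.cast_zero, mul_zero, div_zero] at hεC
      linarith
    · exact_mod_cast h
  have hη : 3 * ε * C ≤ 1 / 2 := by
    rw [le_div_iff₀ (by positivity)] at hεC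
    linarith
  have hd : (0 : ℝ) < 2 ^ n := by positivity
  have h0 : ∀ B ∈ 𝓑.parts, (0 : PauliIdx n) ∉ B := fun B hB h =>
    Finset.notMem_erase 0 _ (𝓑.le hB h)
  have hp₀ : blockRates 0 ∅ ∈ stdSimplex ℝ (PauliIdx n) :=
    blockRates_mem_stdSimplex (by simp) le_rfl (by simp)
  set P := S.prob (pauliChannel (blockRates 0 ∅)) with hP
  set r : ℝ := 2 * (3 * ε) ^ 2 * C with hr
  have hblock : ∀ B ∈ 𝓑.parts, 1 / 9 ≤ ∑ o : S.Outcome, P o *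
      (S.gain r B m (o.take (m + 1) (Nat.le_succ _)) +
        infoGain r B (S.povm (o.take (m + 1) (Nat.le_succ _)))) := by
    intro B hB
    have hBC : (B.card : ℝ) ≤ C := by exact_mod_cast hC B hB
    have hp : blockRates (3 * ε) B ∈ stdSimplex ℝ (PauliIdx n) :=
      blockRates_mem_stdSimplex (h0 B hB) (by positivity) (by
        have := mul_le_mul_of_nonneg_left hBC (show 0 ≤ 3 * ε by positivity)
        linarith)
    obtain ⟨L, hL, hLr, hD⟩ := S.exists_likelihood_ratio_prob (h0 B hB) (hC B hB)
      (by positivity) hη hp hp₀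
    exact (S.one_div_nine_le_relative_entropy hε hS hB (h0 B hB) (𝓑.nonempty_of_mem_parts hB)
      hp hp₀ hL hLr).trans hD
  have hupper : (𝓑.parts.card : ℝ) * (1 / 9) ≤ r * 2 ^ n * S.numMeas := by
    calc (𝓑.parts.card : ℝ) * (1 / 9)
        ≤ ∑ B ∈ 𝓑.parts, ∑ o : S.Outcome, P o *
            (S.gain r B m (o.take (m + 1) (Nat.le_succ _)) +
              infoGain r B (S.povm (o.take (m + 1) (Nat.le_succ _)))) := by
          simpa using Finset.card_nsmul_le_sum _ _ _ hblock
      -- The exchange is possible because `P` is the same null law for every block.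
      _ = ∑ o : S.Outcome, P o * ∑ B ∈ 𝓑.parts,
            (S.gain r B m (o.take (m + 1) (Nat.le_succ _)) +
              infoGain r B (S.povm (o.take (m + 1) (Nat.le_succ _)))) := by
          rw [Finset.sum_comm]
          simp_rw [Finset.mul_sum]
      _ ≤ ∑ o : S.Outcome, P o * (r * 2 ^ n * S.numMeas) :=
          Finset.sum_le_sum fun o _ => mul_le_mul_of_nonneg_left
            (S.sum_gain_le (by positivity) 𝓑 _) (S.prob_null_nonneg hp₀ o)
      _ = r * 2 ^ n * S.numMeas := by
          rw [← Finset.sum_mul, S.sum_prob (pauliChannel_isTP hp₀), one_mul]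
  have hcard := three_mul_four_pow_le_card_parts hn 𝓑 hC
  have h1 : 3 * (2 ^ n * 2 ^ n : ℝ) ≤ 4 * (9 * (r * 2 ^ n * S.numMeas) * C) := by
    have := mul_le_mul_of_nonneg_right hupper hC0.le
    linarith
  have h2 : 2 ^ n * (3 * 2 ^ n : ℝ) ≤ 2 ^ n * (648 * (S.numMeas * (ε ^ 2 * C ^ 2))) := by
    rw [hr] at h1
    linarith
  have h3 := le_of_mul_le_mul_left h2 hd
  rw [← mul_div_assoc, div_le_iff₀ (by positivity)]
  linarith
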